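/- Let $\mathcal H$ and $\mathcal K$ be (separable) complex Hilbert spaces and let $\{|i\rangle\}_{i\in\Lambda}$ be an orthonormal basis of $\mathcal K$, with $\Lambda$ finite or countable. Let $(B^i_j)_{i,j\in\Lambda}$ be bounded operators on $\mathcal H$ with $\sum_i B^{i*}_jB^i_j=\mathbf 1$ (strongly) for every $j$, and put $M^i_j=B^i_j\otimes|i\rangle\langle j|$. Let $\rho=\sum_i\rho_i\otimes|i\rangle\langle i|$ be a density operator on $\mathcal H\otimes\mathcal K$: the $\rho_i\ge 0$ are trace class operators on $\mathcal H$ and $\sum_i\mathrm{Tr}(\rho_i)=1$. Let $I_\rho=\{i:\rho_i=0\}$, $I_\rho^c=\Lambda\setminus I_\rho$, and let $\mathcal K^\rho$ be the orthogonal complement in $\mathcal K$ of the closed subspace generated by $\{|i\rangle: i\in I_\rho\}$ (so $\mathcal K^\rho=\mathcal K$ if all $\rho_i\ne 0$). An operator on $\mathcal H\otimes\mathcal K^\rho$ is regarded, where needed, as an operator on $\mathcal H\otimes\mathcal K$ that vanishes on the orthogonal complement of $\mathcal H\otimes\mathcal K^\rho$, and $M^i_j$ with $j\in I_\rho^c$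 is regarded as an operator from $\mathcal H\otimes\mathcal K^\rho$ to $\mathcal H\otimes\mathcal K$. Put $M_0=B(\mathcal H\otimes\mathcal K^\rho)$ and let $\mathcal E:M_0\otimes M_0\to M_0$ be the linear map (transition expectation) $$\mathcal E(x\otimes y)=\sum_{i\in\Lambda,\ j\in I_\rho^c}M^{i*}_j\,x\,M^i_j\;\frac{\mathrm{Tr}\big((\rho_j\otimes|j\rangle\langle j|)\,y\big)}{\mathrm{Tr}(\rho_j)},$$ the series converging strongly. Let $E_{0]}$ be the linear map given on the tensor powers of $M_0$ by $$E_{0]}(a_0\otimes a_1\otimes\cdots\otimes a_n)=\mathcal E\big(a_0\otimes\mathcal E(a_1\otimes\cdots\otimes\mathcal E(a_n\otimes\mathbf 1)\cdots)\big).$$ For a projection $e\in M_0$ put $e^\perp=\mathbf 1-e$ and $\tau^n_\infty=e^\perp\otimes\cdots\otimes e^\perp$ ($n+1$ factors), and for $v\in I_\rho^c$ and $x\in M_0$ put $$\psi_v(x)=\frac1{\mathrm{Tr}(\rho_v)}\sum_{i\in\Lambda}\mathrm{Tr}\big((B^i_v\rho_vB^{i*}_v\otimes|i\rangle\langle i|)\,x\big).$$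 Then for every projection $e\in B(\mathcal H\otimes\mathcal K^\rho)$ and every integer $n\ge 0$, $$\mathcal E\big(e\otimes E_{0]}(\tau^n_\infty)\big)=\sum_{u\in\Lambda,\ v\in I_\rho^c}M^{u*}_v\,e\,M^u_v\,\big(\psi_v(e^\perp)\big)^{n+1},$$ where the series converges strongly. -/

import Mathlib

open scoped TensorProduct InnerProductSpace InnerProduct

noncomputable section

namespace OQRW

/-! ### Strong sums and the trace -/

section General

variable {F G : Type*} [NormedAddCommGroup F] [InnerProductSpace ℂ F] [CompleteSpace F]
  [NormedAddCommGroup G] [InnerProductSpace ℂ G] [CompleteSpace G]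

set_option linter.unusedSectionVars false

/-- The (unconditional) series `∑ p, f p` of bounded operators converges strongly to `T`. -/
def HasStrongSum {P : Type*} (f : P → F →L[ℂ] G) (T : F →L[ℂ] G) : Prop :=
  ∀ ξ : F, HasSum (fun p => f p ξ) (T ξ)

theorem HasStrongSum.unique {P : Type*} {f : P → F →L[ℂ] G} {S T : F →L[ℂ] G}
    (hS : HasStrongSum f S) (hT : HasStrongSum f T) : S = T :=
  ContinuousLinearMap.ext fun ξ => (hS ξ).unique (hT ξ)

open Classical in
/-- The sum of a strongly convergent series of bounded operators. -/
def strongSum {P : Type*} (f : P → F →L[ℂ] G) : F →L[ℂ] G :=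
  if h : ∃ T, HasStrongSum f T then h.choose else 0

theorem HasStrongSum.strongSum_eq {P : Type*} {f : P → F →L[ℂ] G} {T : F →L[ℂ] G}
    (h : HasStrongSum f T) : strongSum f = T := by
  have h' : ∃ T, HasStrongSum f T := ⟨T, h⟩
  rw [strongSum, dif_pos h']
  exact h'.choose_spec.unique h

variable (G) in
/-- The index set of a fixed orthonormal basis of the Hilbert space `G`. -/
def basisSet : Set G := (exists_hilbertBasis ℂ G).choose

variable (G) in
/-- A fixed orthonormal basis of the Hilbert space `G`. -/
def someBasis : HilbertBasis (basisSet G) ℂ G := (exists_hilbertBasis ℂ G).choose_spec.choose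

/-- The trace `Tr T = ∑ ⟨b, T b⟩`, the sum running over an orthonormal basis; it is used for
trace class operators only, for which it does not depend on the basis. -/
def Tr (T : G →L[ℂ] G) : ℂ :=
  ∑' i, ⟪someBasis G i, T (someBasis G i)⟫_ℂ

theorem norm_sq_parseval {ι : Type*} (b : HilbertBasis ι ℂ F) (x : F) :
    ENNReal.ofReal (‖x‖ ^ 2) = ∑' i, ENNReal.ofReal (‖⟪b i, x⟫_ℂ‖ ^ 2) := by
  have h2 : HasSum (fun i => ‖⟪b i, x⟫_ℂ‖ ^ 2) (‖x‖ ^ 2) := by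
    have h3 := Complex.hasSum_re (b.hasSum_inner_mul_inner x x)
    have e2 : (⟪x, x⟫_ℂ).re = ‖x‖ ^ 2 := inner_self_eq_norm_sq (𝕜 := ℂ) x
    rw [e2] at h3
    convert! h3 using 1
    ext i
    rw [← inner_conj_symm x (b i), RCLike.conj_mul]
    norm_cast
  rw [← h2.tsum_eq, ENNReal.ofReal_tsum_of_nonneg (fun _ => by positivity) h2.summable]

theorem tsum_enorm_sq_adjoint {ι κ : Type*} (b : HilbertBasis ι ℂ F) (c : HilbertBasis κ ℂ G)
    (V : F →L[ℂ] G) :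
    ∑' i, ENNReal.ofReal (‖V (b i)‖ ^ 2) = ∑' k, ENNReal.ofReal (‖(V†) (c k)‖ ^ 2) := by
  simp_rw [fun i => norm_sq_parseval c (V (b i)), fun k => norm_sq_parseval b ((V†) (c k))]
  rw [ENNReal.tsum_comm]
  refine tsum_congr fun k => tsum_congr fun i => ?_
  rw [ContinuousLinearMap.adjoint_inner_right, norm_inner_symm]

theorem hasSum_sq_adjoint {ι κ : Type*} (b : HilbertBasis ι ℂ F) (c : HilbertBasis κ ℂ G)
    {V : F →L[ℂ] G} {s : ℝ} (h : HasSum (fun k => ‖(V†) (c k)‖ ^ 2) s) :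
    HasSum (fun i => ‖V (b i)‖ ^ 2) s := by
  have e := tsum_enorm_sq_adjoint b c V
  have hs : 0 ≤ s := h.nonneg fun _ => by positivity
  rw [← ENNReal.ofReal_tsum_of_nonneg (fun _ => by positivity) h.summable, h.tsum_eq] at e
  have hsum : Summable fun i => ‖V (b i)‖ ^ 2 := by
    have := ENNReal.summable_toReal (e.trans_ne ENNReal.ofReal_ne_top)
    simpa [ENNReal.toReal_ofReal, sq_nonneg] using this
  have e2 := hsum.hasSum
  rw [← ENNReal.ofReal_tsum_of_nonneg (fun _ => by positivity) hsum,
    ENNReal.ofReal_eq_ofReal_iff (tsum_nonneg fun _ => by positivity) hs] at e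
  rwa [e] at e2

/-- If `V†` is a Hilbert-Schmidt operator, then `Tr (V† V y)` converges absolutely and is bounded
by `‖y‖` times the square of the Hilbert-Schmidt norm. -/
theorem trace_bound {V : G →L[ℂ] F} {s : ℝ}
    (h : HasSum (fun k => ‖(V†) (someBasis F k)‖ ^ 2) s) (y : G →L[ℂ] G) :
    Summable (fun i => ⟪someBasis G i, (V† ∘L V ∘L y) (someBasis G i)⟫_ℂ) ∧
      ‖Tr (V† ∘L V ∘L y)‖ ≤ s * ‖y‖ := by
  have h1 := hasSum_sq_adjoint (someBasis G) (someBasis F) h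
  have h2 : Summable (fun k => ‖((V ∘L y)†) (someBasis F k)‖ ^ 2) := by
    refine Summable.of_nonneg_of_le (fun _ => by positivity) (fun k => ?_)
      (h.summable.mul_left (‖y‖ ^ 2))
    rw [ContinuousLinearMap.adjoint_comp, ← mul_pow]
    refine pow_le_pow_left₀ (norm_nonneg _) ?_ 2
    have := (y†).le_opNorm ((V†) (someBasis F k))
    rwa [LinearIsometryEquiv.norm_map] at this
  have h2b : ∑' k, ‖((V ∘L y)†) (someBasis F k)‖ ^ 2 ≤ ‖y‖ ^ 2 * s := by
    rw [← h.tsum_eq, ← tsum_mul_left]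
    refine h2.tsum_le_tsum (fun k => ?_) (h.summable.mul_left (‖y‖ ^ 2))
    rw [ContinuousLinearMap.adjoint_comp, ← mul_pow]
    refine pow_le_pow_left₀ (norm_nonneg _) ?_ 2
    have := (y†).le_opNorm ((V†) (someBasis F k))
    rwa [LinearIsometryEquiv.norm_map] at this
  have h3 := hasSum_sq_adjoint (someBasis G) (someBasis F) h2.hasSum
  have hterm : ∀ i, ⟪someBasis G i, (V† ∘L V ∘L y) (someBasis G i)⟫_ℂ
      = ⟪V (someBasis G i), (V ∘L y) (someBasis G i)⟫_ℂ := fun i => by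
    simp [ContinuousLinearMap.adjoint_inner_right]
  have hle : ∀ i, ‖⟪someBasis G i, (V† ∘L V ∘L y) (someBasis G i)⟫_ℂ‖
      ≤ ‖V (someBasis G i)‖ * ‖(V ∘L y) (someBasis G i)‖ := fun i => by
    rw [hterm]; exact norm_inner_le_norm _ _
  have hs : 0 ≤ s := h.nonneg fun _ => by positivity
  have hCS := Real.summable_and_inner_le_Lp_mul_Lq_tsum_of_nonneg
    (Real.HolderConjugate.two_two) (f := fun i => ‖V (someBasis G i)‖)
    (g := fun i => ‖(V ∘L y) (someBasis G i)‖) (fun _ => norm_nonneg _) (fun _ => norm_nonneg _)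
    (by simpa using h1.summable) (by simpa using h3.summable)
  have hsn : Summable fun i => ‖⟪someBasis G i, (V† ∘L V ∘L y) (someBasis G i)⟫_ℂ‖ :=
    Summable.of_nonneg_of_le (fun _ => norm_nonneg _) hle hCS.1
  refine ⟨hsn.of_norm, (norm_tsum_le_tsum_norm hsn).trans ((hsn.tsum_le_tsum hle hCS.1).trans
    (hCS.2.trans ?_))⟩
  have e1 : ∑' i, ‖V (someBasis G i)‖ ^ (2 : ℝ) = s := by simpa using h1.tsum_eq
  have e3 : ∑' i, ‖(V ∘L y) (someBasis G i)‖ ^ (2 : ℝ) ≤ ‖y‖ ^ 2 * s := by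
    simpa using h3.tsum_eq.le.trans h2b
  rw [e1, ← Real.sqrt_eq_rpow, ← Real.sqrt_eq_rpow]
  calc √s * √(∑' i, ‖(V ∘L y) (someBasis G i)‖ ^ (2 : ℝ)) ≤ √s * √(‖y‖ ^ 2 * s) := by gcongr
    _ = s * ‖y‖ := by
      rw [Real.sqrt_mul (by positivity), Real.sqrt_sq (norm_nonneg _)]
      rw [mul_left_comm, Real.mul_self_sqrt hs, mul_comm]

/-- Strong convergence of `∑ A† X A` when `∑ A† A ≤ 1` and the `X` are uniformly bounded. -/
theorem exists_hasStrongSum {P : Type*} (A : P → F →L[ℂ] G) (X : P → G →L[ℂ] G) {C : ℝ}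
    (hC : 0 ≤ C) (hX : ∀ p, ‖X p‖ ≤ C)
    (hA : ∀ (ξ : F) (s : Finset P), ∑ p ∈ s, ‖A p ξ‖ ^ 2 ≤ ‖ξ‖ ^ 2) :
    ∃ T, HasStrongSum (fun p => (A p)† ∘L X p ∘L A p) T := by
  have hsum : ∀ ξ, Summable fun p => ‖A p ξ‖ ^ 2 := fun ξ =>
    summable_of_sum_le (fun _ => by positivity) (hA ξ)
  have bound : ∀ (ξ : F) (s : Finset P),
      ‖∑ p ∈ s, ((A p)† ∘L X p ∘L A p) ξ‖ ≤ C * √(∑ p ∈ s, ‖A p ξ‖ ^ 2) := by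
    intro ξ s
    set v := ∑ p ∈ s, ((A p)† ∘L X p ∘L A p) ξ with hv
    by_cases hv0 : ‖v‖ = 0
    · rw [hv0]; positivity
    have h1 : ‖v‖ ^ 2 ≤ ∑ p ∈ s, ‖A p v‖ * (C * ‖A p ξ‖) := by
      have : ‖v‖ ^ 2 = ‖⟪v, v⟫_ℂ‖ := by
        rw [inner_self_eq_norm_sq_to_K]; simp
      rw [this]
      nth_rw 2 [hv]
      rw [inner_sum]
      refine (norm_sum_le _ _).trans (Finset.sum_le_sum fun p _ => ?_)
      have e : ⟪v, ((A p)† ∘L X p ∘L A p) ξ⟫_ℂ = ⟪A p v, X p (A p ξ)⟫_ℂ := by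
        simp [ContinuousLinearMap.adjoint_inner_right]
      rw [e]
      refine (norm_inner_le_norm _ _).trans ?_
      gcongr
      exact ((X p).le_opNorm _).trans (by gcongr; exact hX p)
    have h2 : ∑ p ∈ s, ‖A p v‖ * (C * ‖A p ξ‖)
        ≤ ‖v‖ * (C * √(∑ p ∈ s, ‖A p ξ‖ ^ 2)) := by
      have hcs := Real.sum_mul_le_sqrt_mul_sqrt s (fun p => ‖A p v‖) (fun p => ‖A p ξ‖)
      have hb : √(∑ p ∈ s, ‖A p v‖ ^ 2) ≤ ‖v‖ :=
        (Real.sqrt_le_sqrt (hA v s)).trans (Real.sqrt_sq (norm_nonneg _)).le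
      calc ∑ p ∈ s, ‖A p v‖ * (C * ‖A p ξ‖) = C * ∑ p ∈ s, ‖A p v‖ * ‖A p ξ‖ := by
            rw [Finset.mul_sum]; exact Finset.sum_congr rfl fun _ _ => by ring
        _ ≤ C * (‖v‖ * √(∑ p ∈ s, ‖A p ξ‖ ^ 2)) := by
            gcongr; exact hcs.trans (by gcongr)
        _ = _ := by ring
    have hpos : 0 < ‖v‖ := lt_of_le_of_ne (norm_nonneg _) (Ne.symm hv0)
    have h3 := h1.trans h2
    rw [sq] at h3
    exact le_of_mul_le_mul_left h3 hpos
  have hS : ∀ ξ, Summable fun p => ((A p)† ∘L X p ∘L A p) ξ := by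
    intro ξ
    rw [summable_iff_vanishing_norm]
    intro ε hε
    obtain ⟨s, hs⟩ := summable_iff_vanishing_norm.1 (hsum ξ) ((ε / (C + 1)) ^ 2) (by positivity)
    refine ⟨s, fun t ht => (bound ξ t).trans_lt ?_⟩
    have h1 := hs t ht
    rw [Real.norm_of_nonneg (Finset.sum_nonneg fun _ _ => by positivity)] at h1
    have h2 : √(∑ p ∈ t, ‖A p ξ‖ ^ 2) < ε / (C + 1) := by
      rw [Real.sqrt_lt' (by positivity)]; exact h1
    calc C * √(∑ p ∈ t, ‖A p ξ‖ ^ 2) ≤ C * (ε / (C + 1)) := by gcongr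
      _ < ε := by rw [← mul_div_assoc, div_lt_iff₀ (by positivity)]; nlinarith
  refine ⟨LinearMap.mkContinuous
    { toFun := fun ξ => ∑' p, ((A p)† ∘L X p ∘L A p) ξ
      map_add' := fun ξ η => by
        simp only [map_add]; exact (hS ξ).tsum_add (hS η)
      map_smul' := fun c ξ => by
        simp only [map_smul, RingHom.id_apply]; exact (hS ξ).tsum_const_smul c } C ?_, ?_⟩
  · intro ξ
    refine le_of_tendsto ((hS ξ).hasSum.norm) (Filter.Eventually.of_forall fun s => ?_)
    refine (bound ξ s).trans ?_
    gcongr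
    exact (Real.sqrt_le_sqrt (hA ξ s)).trans (Real.sqrt_sq (norm_nonneg _)).le
  · intro ξ
    exact (hS ξ).hasSum

end General

/-! ### Hilbert space tensor products -/

section Tensor

variable {H K K' : Type*} [NormedAddCommGroup H] [InnerProductSpace ℂ H] [CompleteSpace H]
  [NormedAddCommGroup K] [InnerProductSpace ℂ K] [CompleteSpace K]
  [NormedAddCommGroup K'] [InnerProductSpace ℂ K'] [CompleteSpace K']

set_option linter.unusedSectionVars false

/-- The Hilbert space tensor product: the completion of the algebraic tensor product. -/
abbrev HilbertTensor (H K : Type*) [NormedAddCommGroup H] [InnerProductSpace ℂ H]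
    [NormedAddCommGroup K] [InnerProductSpace ℂ K] : Type _ :=
  UniformSpace.Completion (H ⊗[ℂ] K)

/-- The bounded operator `A ⊗ C` on Hilbert space tensor products. -/
def tensorOp (A : H →L[ℂ] H) (C : K →L[ℂ] K') : HilbertTensor H K →L[ℂ] HilbertTensor H K' :=
  (TensorProduct.mapL A C).completion

/-- The operator `|k⟩⟨k'|`. -/
abbrev ketBra (k : K') (k' : K) : K →L[ℂ] K' := InnerProductSpace.rankOne ℂ k k'

/-- The operator `h ↦ h ⊗ k`. -/
def ket (H : Type*) [NormedAddCommGroup H] [InnerProductSpace ℂ H] (k : K) :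
    H →L[ℂ] HilbertTensor H K :=
  UniformSpace.Completion.toComplL ∘L
    (LinearMap.mkContinuous ((TensorProduct.mk ℂ H K).flip k) ‖k‖ fun h => by
      simp [TensorProduct.norm_tmul, mul_comm])

theorem ket_apply (k : K) (h : H) :
    ket H k h = ((h ⊗ₜ[ℂ] k : H ⊗[ℂ] K) : HilbertTensor H K) := rfl

theorem inner_ket (k l : K) (h g : H) : ⟪ket H k h, ket H l g⟫_ℂ = ⟪h, g⟫_ℂ * ⟪k, l⟫_ℂ := by
  rw [ket_apply, ket_apply, UniformSpace.Completion.inner_coe, TensorProduct.inner_tmul]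

theorem adjoint_ket_ket (k l : K) (h : H) : (ket H k†) (ket H l h) = ⟪k, l⟫_ℂ • h := by
  refine ext_inner_left ℂ fun g => ?_
  rw [ContinuousLinearMap.adjoint_inner_right, inner_ket, inner_smul_right, mul_comm]

theorem norm_ket (k : K) (hk : ‖k‖ = 1) (h : H) : ‖ket H k h‖ = ‖h‖ := by
  rw [ket_apply, UniformSpace.Completion.norm_coe, TensorProduct.norm_tmul, hk, mul_one]

theorem ext_ket {E : Type*} [NormedAddCommGroup E] [InnerProductSpace ℂ E]
    {S T : HilbertTensor H K →L[ℂ] E} (h : ∀ k g, S (ket H k g) = T (ket H k g)) : S = T := by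
  ext ξ
  refine UniformSpace.Completion.induction_on ξ (isClosed_eq S.continuous T.continuous) fun a => ?_
  induction a with
  | zero => rw [UniformSpace.Completion.coe_zero, map_zero, map_zero]
  | tmul g k => exact h k g
  | add x y hx hy => rw [UniformSpace.Completion.coe_add, map_add, map_add, hx, hy]

theorem tensorOp_ketBra (A : H →L[ℂ] H) (k' : K') (k : K) :
    tensorOp A (ketBra k' k) = ket H k' ∘L A ∘L (ket H k†) := by
  refine ext_ket fun l g => ?_
  rw [ContinuousLinearMap.comp_apply, ContinuousLinearMap.comp_apply, adjoint_ket_ket, map_smul,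
    map_smul, ket_apply, ket_apply, tensorOp, ContinuousLinearMap.completion_apply_coe,
    TensorProduct.mapL_tmul, InnerProductSpace.rankOne_apply, TensorProduct.tmul_smul,
    UniformSpace.Completion.coe_smul]

theorem bessel_ket {ι : Type*} {v : ι → K} (hv : Orthonormal ℂ v) (ξ : HilbertTensor H K)
    (s : Finset ι) : ∑ i ∈ s, ‖(ket H (v i)†) ξ‖ ^ 2 ≤ ‖ξ‖ ^ 2 := by
  classical
  set a : ι → H := fun i => (ket H (v i)†) ξ
  set η := ∑ i ∈ s, ket H (v i) (a i) with hη
  have h1 : ⟪η, ξ⟫_ℂ = ((∑ i ∈ s, ‖a i‖ ^ 2 : ℝ) : ℂ) := by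
    rw [hη, sum_inner, Complex.ofReal_sum]
    refine Finset.sum_congr rfl fun i _ => ?_
    rw [← ContinuousLinearMap.adjoint_inner_right, inner_self_eq_norm_sq_to_K]
    norm_cast
  have h2 : ⟪η, η⟫_ℂ = ((∑ i ∈ s, ‖a i‖ ^ 2 : ℝ) : ℂ) := by
    nth_rw 1 [hη]
    rw [sum_inner, Complex.ofReal_sum]
    refine Finset.sum_congr rfl fun i hi => ?_
    rw [hη, inner_sum, Finset.sum_eq_single i]
    · rw [inner_ket, inner_self_eq_norm_sq_to_K, inner_self_eq_norm_sq_to_K, hv.1 i]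
      simp
    · intro j _ hj
      rw [inner_ket, hv.2 (Ne.symm hj), mul_zero]
    · exact fun h => absurd hi h
  have h3 : ‖η‖ ^ 2 = ∑ i ∈ s, ‖a i‖ ^ 2 := by
    have h5 := congrArg Complex.re h2
    rw [Complex.ofReal_re] at h5
    rw [← h5]
    exact (inner_self_eq_norm_sq (𝕜 := ℂ) η).symm
  have h4 : ∑ i ∈ s, ‖a i‖ ^ 2 ≤ ‖η‖ * ‖ξ‖ := by
    have := norm_inner_le_norm (𝕜 := ℂ) η ξ
    rw [h1, Complex.norm_real, Real.norm_of_nonneg (Finset.sum_nonneg fun _ _ => by positivity)]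
      at this
    exact this
  rw [← h3] at h4 ⊢
  nlinarith [norm_nonneg η, norm_nonneg ξ, sq_nonneg (‖η‖ - ‖ξ‖)]

end Tensor

/-! ### Open quantum random walks -/

/-- The transition operators `B^i_j` of an open quantum random walk with internal Hilbert space `H`
and set of sites `L`; `B i j` describes the passage from the site `j` to the site `i`. -/
structure OpenWalk (H L : Type*) [NormedAddCommGroup H] [InnerProductSpace ℂ H]
    [CompleteSpace H] where
  /-- `B i j` is `B^i_j` -/
  B : L → L → H →L[ℂ] H
  /-- `∑ i, (B^i_j)* B^i_j = 1` for every `j`, with strong convergence -/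
  sum_eq_one : ∀ j, HasStrongSum (fun i => (B i j)† ∘L B i j) 1

/-- A density operator `∑ i, ρ_i ⊗ |i⟩⟨i|`, given by its diagonal blocks: positive trace class
operators `ρ_i` with `∑ i, Tr ρ_i = 1`. -/
structure BlockDensity (H L : Type*) [NormedAddCommGroup H] [InnerProductSpace ℂ H]
    [CompleteSpace H] where
  /-- the blocks `ρ_i` -/
  ρ : L → H →L[ℂ] H
  isPositive : ∀ i, (ρ i).IsPositive
  traceClass : ∀ i, Summable fun k => ⟪someBasis H k, ρ i (someBasis H k)⟫_ℂ
  trace_eq_one : HasSum (fun i => Tr (ρ i)) 1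

section Chain

variable {H K L : Type*} [NormedAddCommGroup H] [InnerProductSpace ℂ H] [CompleteSpace H]
  [NormedAddCommGroup K] [InnerProductSpace ℂ K] [CompleteSpace K]
  (b : HilbertBasis L ℂ K) (W : OpenWalk H L) (D : BlockDensity H L)

set_option linter.unusedSectionVars false

/-- The complement of `I_ρ = {i | ρ_i = 0}`. -/
abbrev Supp : Type _ := {i : L // D.ρ i ≠ 0}

/-- `K^ρ`, the orthogonal complement in `K` of the closed subspace `K_ρ` generated by the `|i⟩`
with `ρ_i = 0`. -/
abbrev Krho : Submodule ℂ K :=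
  (Submodule.span ℂ (b '' {i | D.ρ i = 0})).topologicalClosureᗮ

/-- The basis vector `|j⟩`, for `ρ_j ≠ 0`, as a vector of `K^ρ`. -/
def site (j : Supp D) : Krho b D :=
  ⟨b j, by
    rw [Krho, Submodule.orthogonal_closure, Submodule.mem_orthogonal]
    intro u hu
    induction hu using Submodule.span_induction with
    | mem x hx =>
      obtain ⟨i, hi, rfl⟩ := hx
      exact b.orthonormal.2 fun h => j.2 (h ▸ hi)
    | zero => simp
    | add x y _ _ hx hy => rw [inner_add_left, hx, hy, add_zero]
    | smul c x _ hx => rw [inner_smul_left, hx, mul_zero]⟩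

/-- The algebra `B(H ⊗ K^ρ)`. -/
abbrev M0 : Type _ := HilbertTensor H (Krho b D) →L[ℂ] HilbertTensor H (Krho b D)

/-- The inclusion of `H ⊗ K^ρ` in `H ⊗ K`. -/
def incl : HilbertTensor H (Krho b D) →L[ℂ] HilbertTensor H K :=
  tensorOp (ContinuousLinearMap.id ℂ H) (Krho b D).subtypeL

/-- An operator on `H ⊗ K^ρ`, viewed as the operator on `H ⊗ K` which vanishes on the orthogonal
complement of `H ⊗ K^ρ`. -/
def extend (x : M0 b D) : HilbertTensor H K →L[ℂ] HilbertTensor H K :=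
  incl b D ∘L x ∘L (incl b D†)

/-- The operators `M^i_j = B^i_j ⊗ |i⟩⟨j|`, for `i ∈ L` and `ρ_j ≠ 0`, defined on `H ⊗ K^ρ`. -/
def M (i : L) (j : Supp D) : HilbertTensor H (Krho b D) →L[ℂ] HilbertTensor H K :=
  tensorOp (W.B i j) (ketBra (b i) (site b D j))

/-- `Tr((ρ_j ⊗ |j⟩⟨j|) y) / Tr(ρ_j)`. -/
def blockState (j : Supp D) (y : M0 b D) : ℂ :=
  Tr (tensorOp (D.ρ j) (ketBra (site b D j) (site b D j)) ∘L y) / Tr (D.ρ j)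

/-- `ψ_v(x) = (1 / Tr ρ_v) ∑ i, Tr((B^i_v ρ_v (B^i_v)* ⊗ |i⟩⟨i|) x)`. -/
def psi (v : Supp D) (x : M0 b D) : ℂ :=
  1 / Tr (D.ρ v) *
    ∑' i : L, Tr (tensorOp (W.B i v ∘L D.ρ v ∘L (W.B i v†)) (ketBra (b i) (b i)) ∘L extend b D x)

/-- The terms of the series which defines the transition expectation. -/
def summand (x y : M0 b D) (p : L × Supp D) : M0 b D :=
  blockState b D p.2 y • ((M b W D p.1 p.2)† ∘L extend b D x ∘L M b W D p.1 p.2)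

theorem ρ_factor (j : L) : ∃ R : H →L[ℂ] H, R† = R ∧ D.ρ j = R ∘L R ∧
    HasSum (fun k => ‖R (someBasis H k)‖ ^ 2) (Tr (D.ρ j)).re := by
  have h0 : 0 ≤ D.ρ j := (ContinuousLinearMap.nonneg_iff_isPositive _).2 (D.isPositive j)
  have hR : (CFC.sqrt (D.ρ j))† = CFC.sqrt (D.ρ j) :=
    (CFC.sqrt_nonneg (D.ρ j)).isSelfAdjoint.adjoint_eq
  have hRR : D.ρ j = CFC.sqrt (D.ρ j) ∘L CFC.sqrt (D.ρ j) := (CFC.sqrt_mul_sqrt_self _ h0).symm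
  refine ⟨CFC.sqrt (D.ρ j), hR, hRR, ?_⟩
  have h := Complex.hasSum_re (D.traceClass j).hasSum
  convert! h using 1
  ext k
  have e : ⟪someBasis H k, D.ρ j (someBasis H k)⟫_ℂ =
      ⟪CFC.sqrt (D.ρ j) (someBasis H k), CFC.sqrt (D.ρ j) (someBasis H k)⟫_ℂ := by
    conv_lhs => rw [hRR]
    rw [ContinuousLinearMap.comp_apply, ← ContinuousLinearMap.adjoint_inner_left, hR]
  rw [e]
  exact (inner_self_eq_norm_sq (𝕜 := ℂ) _).symm

theorem orthonormal_site : Orthonormal ℂ (site b D) := by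
  constructor
  · intro j; exact b.orthonormal.1 j
  · intro i j hij; exact b.orthonormal.2 (fun h => hij (Subtype.ext h))

theorem blockTrace (j : Supp D) (y : M0 b D) :
    (Summable fun i => ⟪someBasis _ i, (tensorOp (D.ρ j) (ketBra (site b D j) (site b D j)) ∘L y)
      (someBasis _ i)⟫_ℂ) ∧
    ‖Tr (tensorOp (D.ρ j) (ketBra (site b D j) (site b D j)) ∘L y)‖ ≤ (Tr (D.ρ j)).re * ‖y‖ := by
  obtain ⟨R, hR, hRR, hs⟩ := ρ_factor D j
  have hV : tensorOp (D.ρ j) (ketBra (site b D j) (site b D j)) ∘L y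
      = (R ∘L (ket H (site b D j)†))† ∘L (R ∘L (ket H (site b D j)†)) ∘L y := by
    rw [tensorOp_ketBra, ContinuousLinearMap.adjoint_comp, ContinuousLinearMap.adjoint_adjoint, hR,
      hRR]
    rfl
  rw [hV]
  refine trace_bound ?_ y
  convert! hs using 1
  ext k
  rw [ContinuousLinearMap.adjoint_comp, ContinuousLinearMap.adjoint_adjoint, hR,
    ContinuousLinearMap.comp_apply, norm_ket _ ((orthonormal_site b D).1 j)]

theorem norm_blockState_le (j : Supp D) (y : M0 b D) : ‖blockState b D j y‖ ≤ ‖y‖ := by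
  obtain ⟨R, hR, hRR, hs⟩ := ρ_factor D j
  have h0 : 0 ≤ (Tr (D.ρ j)).re := hs.nonneg fun _ => by positivity
  rw [blockState, norm_div]
  refine div_le_of_le_mul₀ (norm_nonneg _) (norm_nonneg y) ?_
  refine (blockTrace b D j y).2.trans ?_
  rw [mul_comm]
  gcongr
  exact Complex.re_le_norm _

theorem blockState_add (j : Supp D) (y z : M0 b D) :
    blockState b D j (y + z) = blockState b D j y + blockState b D j z := by
  rw [blockState, blockState, blockState, ← add_div]
  congr 1
  have := (blockTrace b D j y).1.tsum_add (blockTrace b D j z).1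
  rw [Tr, Tr, Tr, ← this]
  refine tsum_congr fun i => ?_
  rw [ContinuousLinearMap.comp_add, _root_.add_apply, inner_add_right]

theorem blockState_smul (j : Supp D) (c : ℂ) (y : M0 b D) :
    blockState b D j (c • y) = c * blockState b D j y := by
  rw [blockState, blockState, ← mul_div_assoc]
  congr 1
  rw [Tr, Tr, ← tsum_mul_left]
  refine tsum_congr fun i => ?_
  rw [ContinuousLinearMap.comp_smul, _root_.smul_apply, inner_smul_right]

theorem sum_norm_M_sq_le (ξ : HilbertTensor H (Krho b D)) (s : Finset (L × Supp D)) :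
    ∑ p ∈ s, ‖M b W D p.1 p.2 ξ‖ ^ 2 ≤ ‖ξ‖ ^ 2 := by
  classical
  have hM : ∀ i j, ‖M b W D i j ξ‖ ^ 2 = ‖W.B i j ((ket H (site b D j)†) ξ)‖ ^ 2 := fun i j => by
    rw [M, tensorOp_ketBra, ContinuousLinearMap.comp_apply, norm_ket _ (b.orthonormal.1 i)]
    rfl
  have hB : ∀ (j : L) (h : H), HasSum (fun i => ‖W.B i j h‖ ^ 2) (‖h‖ ^ 2) := fun j h => by
    have h1 := Complex.hasSum_re ((W.sum_eq_one j h).mapL (innerSL ℂ h))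
    convert! h1 using 1
    · ext i
      simp only [innerSL_apply_apply, ContinuousLinearMap.comp_apply,
        ContinuousLinearMap.adjoint_inner_right]
      exact (inner_self_eq_norm_sq (𝕜 := ℂ) _).symm
    · exact (inner_self_eq_norm_sq (𝕜 := ℂ) h).symm
  calc ∑ p ∈ s, ‖M b W D p.1 p.2 ξ‖ ^ 2
      ≤ ∑ p ∈ s.image Prod.fst ×ˢ s.image Prod.snd, ‖M b W D p.1 p.2 ξ‖ ^ 2 :=
        Finset.sum_le_sum_of_subset_of_nonneg Finset.subset_product fun _ _ _ => by positivity
    _ = ∑ j ∈ s.image Prod.snd, ∑ i ∈ s.image Prod.fst,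
          ‖W.B i j ((ket H (site b D j)†) ξ)‖ ^ 2 := by
        rw [Finset.sum_product_right]
        exact Finset.sum_congr rfl fun j _ => Finset.sum_congr rfl fun i _ => hM i j
    _ ≤ ∑ j ∈ s.image Prod.snd, ‖(ket H (site b D j)†) ξ‖ ^ 2 :=
        Finset.sum_le_sum fun j _ => sum_le_hasSum _ (fun _ _ => by positivity) (hB j _)
    _ ≤ ‖ξ‖ ^ 2 := bessel_ket (orthonormal_site b D) ξ _

theorem exists_hasStrongSum_summand (x y : M0 b D) : ∃ T, HasStrongSum (summand b W D x y) T := by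
  obtain ⟨T, hT⟩ := exists_hasStrongSum (fun p : L × Supp D => M b W D p.1 p.2)
    (fun p => blockState b D p.2 y • extend b D x) (C := ‖y‖ * ‖extend b D x‖) (by positivity)
    (fun p => by
      rw [norm_smul]
      gcongr
      exact norm_blockState_le b D p.2 y) (sum_norm_M_sq_le b W D)
  refine ⟨T, ?_⟩
  convert hT using 2
  ext ξ
  simp [summand]

theorem hasStrongSum_summand (x y : M0 b D) :
    HasStrongSum (summand b W D x y) (strongSum (summand b W D x y)) := by
  obtain ⟨T, hT⟩ := exists_hasStrongSum_summand b W D x y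
  rwa [hT.strongSum_eq]

/-- The transition expectation `E : M₀ ⊗ M₀ → M₀`,
`E(x ⊗ y) = ∑ i j, (Tr((ρ_j ⊗ |j⟩⟨j|) y) / Tr(ρ_j)) (M^i_j)* x M^i_j`,
where `i ∈ L`, `ρ_j ≠ 0`, and the series converges strongly. -/
def transExp : M0 b D ⊗[ℂ] M0 b D →ₗ[ℂ] M0 b D :=
  TensorProduct.lift (LinearMap.mk₂ ℂ (fun x y => strongSum (summand b W D x y))
    (fun x x' y => HasStrongSum.strongSum_eq fun ξ => by
      convert! (hasStrongSum_summand b W D x y ξ).add (hasStrongSum_summand b W D x' y ξ) using 1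
      ext p
      simp [summand, extend])
    (fun c x y => HasStrongSum.strongSum_eq fun ξ => by
      convert! (hasStrongSum_summand b W D x y ξ).const_smul c using 1
      ext p
      simp [summand, extend, smul_comm c])
    (fun x y y' => HasStrongSum.strongSum_eq fun ξ => by
      convert! (hasStrongSum_summand b W D x y ξ).add (hasStrongSum_summand b W D x y' ξ) using 1
      ext p
      simp [summand, blockState_add, add_smul])
    (fun c x y => HasStrongSum.strongSum_eq fun ξ => by
      convert! (hasStrongSum_summand b W D x y ξ).const_smul c using 1
      ext p
      simp [summand, blockState_smul, mul_smul]))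

theorem hasStrongSum_transExp (x y : M0 b D) :
    HasStrongSum (summand b W D x y) (transExp b W D (x ⊗ₜ[ℂ] y)) :=
  hasStrongSum_summand b W D x y

end Chain

/-! ### Quantum Markov chains and the stopping time -/

section MarkovChain

variable {A : Type*} [Ring A] [Algebra ℂ A] (E : A ⊗[ℂ] A →ₗ[ℂ] A)

variable (A) in
/-- The local algebra `A_{n]}`: the tensor product of the factors `0, …, n`, all equal to `A`. -/
abbrev LocalAlg (n : ℕ) : Type _ := ⨂[ℂ] _ : Fin (n + 1), A

/-- `a_0 ⊗ a_1 ⊗ ⋯ ⊗ a_n`, an element of `A_{n]}`. -/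
def pureTensor (n : ℕ) (a : Fin (n + 1) → A) : LocalAlg A n := PiTensorProduct.tprod ℂ a

/-- `(a_0, …, a_n) ↦ E(a_0 ⊗ E(a_1 ⊗ ⋯ E(a_n ⊗ 1) ⋯ ))` -/
def nested : (n : ℕ) → MultilinearMap ℂ (fun _ : Fin (n + 1) => A) A
  | 0 => LinearMap.uncurryLeft
      { toFun := fun a => MultilinearMap.constOfIsEmpty ℂ _ (E (a ⊗ₜ[ℂ] 1))
        map_add' := fun a a' => by ext; simp [TensorProduct.add_tmul]
        map_smul' := fun c a => by ext; simp [← TensorProduct.smul_tmul'] }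
  | n + 1 => LinearMap.uncurryLeft
      { toFun := fun a => (E ∘ₗ TensorProduct.mk ℂ _ _ a).compMultilinearMap (nested n)
        map_add' := fun a a' => by ext; simp
        map_smul' := fun c a => by ext; simp }

/-- The restriction to `A_{n]}` of the map `E_{0]}` associated with the transition expectation `E`:
`E_{0]}(a_0 ⊗ a_1 ⊗ ⋯ ⊗ a_n) = E(a_0 ⊗ E(a_1 ⊗ ⋯ E(a_n ⊗ 1) ⋯ ))`. -/
def E0 (n : ℕ) : LocalAlg A n →ₗ[ℂ] A := PiTensorProduct.lift (nested E n)

theorem E0_pureTensor (n : ℕ) (a : Fin (n + 1) → A) :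
    E0 E n (pureTensor n a) = nested E n a := PiTensorProduct.lift.tprod a

theorem E0_zero (a : Fin 1 → A) : E0 E 0 (pureTensor 0 a) = E (a 0 ⊗ₜ[ℂ] 1) :=
  E0_pureTensor E 0 a

theorem E0_succ (n : ℕ) (a : Fin (n + 2) → A) :
    E0 E (n + 1) (pureTensor (n + 1) a) =
      E (a 0 ⊗ₜ[ℂ] E0 E n (pureTensor n fun i => a i.succ)) := by
  rw [E0_pureTensor, E0_pureTensor]
  rfl

/-- The maps `E_{0]}` on the algebras `A_{n]}` are restrictions of each other, under the inclusions
`x ↦ x ⊗ 1`, as soon as `E(1 ⊗ 1) = 1`. -/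
theorem E0_compatible (h1 : E (1 ⊗ₜ[ℂ] 1) = 1) (n : ℕ) (a : Fin (n + 2) → A)
    (ha : a (Fin.last (n + 1)) = 1) :
    E0 E (n + 1) (pureTensor (n + 1) a) = E0 E n (pureTensor n fun i => a i.castSucc) := by
  induction n with
  | zero =>
    have ha' : a (Fin.succ 0) = 1 := ha
    rw [E0_succ, E0_zero, E0_zero, ha', h1]
    rfl
  | succ n ih =>
    rw [E0_succ, ih (fun i => a i.succ) ha, E0_succ]
    rfl

/-- `τ^n_∞ = e^⊥ ⊗ ⋯ ⊗ e^⊥` (`n + 1` factors), where `e^⊥ = 1 - e`, an element of `A_{n]}`. -/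
def tau (n : ℕ) (e : A) : LocalAlg A n := pureTensor n fun _ => 1 - e

end MarkovChain

end OQRW

end

/-! Write `φ_v` for the state `blockState b D v`, that is `y ↦ Tr((ρ_v ⊗ |v⟩⟨v|) y) / Tr ρ_v`.
Everything rests on the factorization `φ_v(E(x ⊗ y)) = ψ_v(x) φ_v(y)` (`blockState_transExp`)
together with `φ_v(1) = 1` (`blockState_one`). Peeling the factors `e^⊥` off the nested expectation
one at a time gives `φ_v(E_{0]}(τ^n_∞)) = ψ_v(e^⊥)^(n+1)`, and the theorem is then the defining
series of `E(e ⊗ y)` at `y = E_{0]}(τ^n_∞)`.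

The factorization holds because `φ_v` only sees vectors `h ⊗ |v⟩`, and `M^i_j` kills these unless `j
= v`. Hence every surviving term of `E(x ⊗ y)` carries the same scalar `φ_v(y)`. What remains is `∑
i, Tr(ρ_v B* ⟨i|x|i⟩ B) / Tr ρ_v` with `B = B^i_v`, which is `ψ_v(x)` by cyclicity of the trace.

The analysis consists in justifying cyclicity and the exchange of sums. Writing `ρ_v = R R` with `R`
self-adjoint and Hilbert-Schmidt (`ρ_factor`), each trace becomes a sum over the basis vectors `R
e_l` (`Tr_tensorOp_ketBra`), and the double sum over `l` and `i` converges absolutely because `∑ i,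
‖B^i_v h‖² = ‖h‖²`. -/

namespace OQRW

set_option linter.unusedSectionVars false

/-! ### Hilbert-Schmidt operators and cyclicity of the trace. -/

section HilbertSchmidt

variable {F G : Type*} [NormedAddCommGroup F] [InnerProductSpace ℂ F] [CompleteSpace F]
  [NormedAddCommGroup G] [InnerProductSpace ℂ G] [CompleteSpace G]

/-- The matrix coefficients of a Hilbert-Schmidt operator are square summable. -/
theorem summable_norm_inner_sq {ι κ : Type*} (b : HilbertBasis ι ℂ F) (c : HilbertBasis κ ℂ G)
    {V : F →L[ℂ] G} (h : Summable fun i => ‖V (b i)‖ ^ 2) :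
    Summable fun p : ι × κ => ‖⟪c p.2, V (b p.1)⟫_ℂ‖ ^ 2 := by
  -- Parseval for `V (b i)` in the basis `c`; since the terms are nonnegative, summing over `k` and
  -- then over `i` decides summability over pairs.
  have e : ∀ i, HasSum (fun k => ‖⟪c k, V (b i)⟫_ℂ‖ ^ 2) (‖V (b i)‖ ^ 2) := fun i => by
    have h3 := Complex.hasSum_re (c.hasSum_inner_mul_inner (V (b i)) (V (b i)))
    have e2 : (⟪V (b i), V (b i)⟫_ℂ).re = ‖V (b i)‖ ^ 2 := inner_self_eq_norm_sq (𝕜 := ℂ) _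
    rw [e2] at h3
    convert! h3 using 1
    ext k
    rw [← inner_conj_symm (V (b i)) (c k), RCLike.conj_mul]
    norm_cast
  rw [summable_prod_of_nonneg fun _ => by positivity]
  refine ⟨fun i => (e i).summable, ?_⟩
  simpa only [fun i => (e i).tsum_eq] using h

/-- The Hilbert-Schmidt inner products of `V`, `W` and of `W†`, `V†` agree. -/
theorem tsum_inner_adjoint {ι κ : Type*} (b : HilbertBasis ι ℂ F) (c : HilbertBasis κ ℂ G)
    {V W : F →L[ℂ] G} (hV : Summable fun i => ‖V (b i)‖ ^ 2)
    (hW : Summable fun i => ‖W (b i)‖ ^ 2) :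
    ∑' i, ⟪V (b i), W (b i)⟫_ℂ = ∑' k, ⟪(W†) (c k), (V†) (c k)⟫_ℂ := by
  -- Absolute convergence, from `s t ≤ s² + t²` applied to the matrix coefficients, is what permits
  -- exchanging the two sums below.
  have hs : Summable fun p : ι × κ => ⟪V (b p.1), c p.2⟫_ℂ * ⟪c p.2, W (b p.1)⟫_ℂ := by
    refine Summable.of_norm_bounded
      ((summable_norm_inner_sq b c hV).add (summable_norm_inner_sq b c hW)) fun p => ?_
    rw [norm_mul, norm_inner_symm]
    nlinarith [sq_nonneg (‖⟪c p.2, V (b p.1)⟫_ℂ‖ - ‖⟪c p.2, W (b p.1)⟫_ℂ‖),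
      sq_nonneg (‖⟪c p.2, V (b p.1)⟫_ℂ‖ + ‖⟪c p.2, W (b p.1)⟫_ℂ‖)]
  calc ∑' i, ⟪V (b i), W (b i)⟫_ℂ
      = ∑' i, ∑' k, ⟪V (b i), c k⟫_ℂ * ⟪c k, W (b i)⟫_ℂ :=
        tsum_congr fun i => (c.hasSum_inner_mul_inner _ _).tsum_eq.symm
    _ = ∑' k, ∑' i, ⟪V (b i), c k⟫_ℂ * ⟪c k, W (b i)⟫_ℂ :=
        (Summable.tsum_comm (f := fun i k => ⟪V (b i), c k⟫_ℂ * ⟪c k, W (b i)⟫_ℂ) hs).symm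
    _ = _ := tsum_congr fun k => by
        rw [← (b.hasSum_inner_mul_inner _ _).tsum_eq]
        refine tsum_congr fun i => ?_
        rw [ContinuousLinearMap.adjoint_inner_left, ContinuousLinearMap.adjoint_inner_right,
          mul_comm]

/-- Cyclicity of the trace: `Tr (V V† y) = Tr (V† y V)` if `V` is a Hilbert-Schmidt operator. -/
theorem Tr_comp_adjoint_comp {V : F →L[ℂ] G} (h : Summable fun k => ‖V (someBasis F k)‖ ^ 2)
    (y : G →L[ℂ] G) :
    Tr (V ∘L (V†) ∘L y) = ∑' k, ⟪V (someBasis F k), y (V (someBasis F k))⟫_ℂ := by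
  -- The trace is the pairing of `V†` with `V† y = (y† V)†`, so the exchange of bases is applied to
  -- the pair `y† V`, `V`.
  have hy : Summable fun k => ‖((y†) ∘L V) (someBasis F k)‖ ^ 2 := by
    refine Summable.of_nonneg_of_le (fun _ => by positivity) (fun k => ?_)
      (h.mul_left (‖y†‖ ^ 2))
    rw [← mul_pow]
    exact pow_le_pow_left₀ (norm_nonneg _) ((y†).le_opNorm _) 2
  have e := tsum_inner_adjoint (someBasis F) (someBasis G) hy h
  rw [Tr]
  calc _ = ∑' k, ⟪(V†) (someBasis G k), (((y†) ∘L V)†) (someBasis G k)⟫_ℂ :=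
        tsum_congr fun k => by
          rw [ContinuousLinearMap.adjoint_comp, ContinuousLinearMap.adjoint_adjoint,
            ContinuousLinearMap.adjoint_inner_left]
          rfl
    _ = _ := e.symm
    _ = _ := tsum_congr fun k => by
          rw [ContinuousLinearMap.comp_apply, ContinuousLinearMap.adjoint_inner_left]

end HilbertSchmidt

/-! ### Factorization of the block states along the transition expectation. -/

section Chain

variable {H K L : Type*} [NormedAddCommGroup H] [InnerProductSpace ℂ H] [CompleteSpace H]
  [NormedAddCommGroup K] [InnerProductSpace ℂ K] [CompleteSpace K]
  (b : HilbertBasis L ℂ K) (W : OpenWalk H L) (D : BlockDensity H L)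

/-- Pair the strong identity `∑ i, (B^i_j)* B^i_j h = h` with `h`. -/
theorem hasSum_norm_B_sq (j : L) (h : H) : HasSum (fun i => ‖W.B i j h‖ ^ 2) (‖h‖ ^ 2) := by
  have h1 := Complex.hasSum_re ((W.sum_eq_one j h).mapL (innerSL ℂ h))
  convert! h1 using 1
  · ext i
    simp only [innerSL_apply_apply, ContinuousLinearMap.comp_apply,
      ContinuousLinearMap.adjoint_inner_right]
    exact (inner_self_eq_norm_sq (𝕜 := ℂ) _).symm
  · exact (inner_self_eq_norm_sq (𝕜 := ℂ) h).symm

/-- If `R` is self-adjoint, then `Tr ((A R R A† ⊗ |k⟩⟨k|) y)` can be computed on `A R h ⊗ k`. -/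
theorem Tr_tensorOp_ketBra {K : Type*} [NormedAddCommGroup K] [InnerProductSpace ℂ K]
    [CompleteSpace K] {R : H →L[ℂ] H} (hR : R† = R)
    (hs : Summable fun k => ‖R (someBasis H k)‖ ^ 2) (A : H →L[ℂ] H) {k : K} (hk : ‖k‖ = 1)
    (y : HilbertTensor H K →L[ℂ] HilbertTensor H K) :
    Tr (tensorOp (A ∘L (R ∘L R) ∘L (A†)) (ketBra k k) ∘L y) =
      ∑' l, ⟪ket H k (A (R (someBasis H l))), y (ket H k (A (R (someBasis H l))))⟫_ℂ := by
  -- The operator is `V V†` for `V h = A R h ⊗ k`, which is Hilbert-Schmidt because `R` is.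
  have e : tensorOp (A ∘L (R ∘L R) ∘L (A†)) (ketBra k k) ∘L y =
      (ket H k ∘L A ∘L R) ∘L ((ket H k ∘L A ∘L R)†) ∘L y := by
    rw [tensorOp_ketBra, ContinuousLinearMap.adjoint_comp, ContinuousLinearMap.adjoint_comp, hR]
    rfl
  rw [e, Tr_comp_adjoint_comp]
  · rfl
  · refine Summable.of_nonneg_of_le (fun _ => by positivity) (fun l => ?_)
      (hs.mul_left (‖A‖ ^ 2))
    rw [ContinuousLinearMap.comp_apply, norm_ket k hk, ContinuousLinearMap.comp_apply, ← mul_pow]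
    exact pow_le_pow_left₀ (norm_nonneg _) (A.le_opNorm _) 2

theorem Tr_tensorOp_site {R : H →L[ℂ] H} (hR : R† = R)
    (hs : Summable fun k => ‖R (someBasis H k)‖ ^ 2) {j : Supp D} (hD : D.ρ j = R ∘L R)
    (y : M0 b D) :
    Tr (tensorOp (D.ρ j) (ketBra (site b D j) (site b D j)) ∘L y) =
      ∑' l, ⟪ket H (site b D j) (R (someBasis H l)),
        y (ket H (site b D j) (R (someBasis H l)))⟫_ℂ := by
  have := Tr_tensorOp_ketBra hR hs (ContinuousLinearMap.id ℂ H) ((orthonormal_site b D).1 j) y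
  rw [ContinuousLinearMap.adjoint_id, ContinuousLinearMap.comp_id, ContinuousLinearMap.id_comp,
    ← hD] at this
  exact this

/-- The real part of `Tr ρ_j` is the squared Hilbert-Schmidt norm of `R`, so a zero trace forces `R
= 0` and then `ρ_j = 0`. This makes the quotient defining `blockState` a genuine normalization. -/
theorem Tr_ρ_ne_zero (j : Supp D) : Tr (D.ρ j) ≠ 0 := by
  intro h0
  obtain ⟨R, hR, hRR, hs⟩ := ρ_factor D j
  rw [h0, Complex.zero_re, hasSum_zero_iff_of_nonneg fun _ => by positivity] at hs
  refine j.2 ?_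
  have hz : R = 0 := by
    refine ContinuousLinearMap.ext fun x => (someBasis H).repr.injective ?_
    ext k
    rw [HilbertBasis.repr_apply_apply, ← ContinuousLinearMap.adjoint_inner_left, hR]
    have := congrFun hs k
    simp only [Pi.zero_apply, sq_eq_zero_iff, norm_eq_zero] at this
    simp [this]
  rw [hRR, hz, ContinuousLinearMap.comp_zero]

theorem blockState_one (j : Supp D) : blockState b D j 1 = 1 := by
  obtain ⟨R, hR, hRR, hs⟩ := ρ_factor D j
  rw [blockState, Tr_tensorOp_site b D hR hs.summable hRR]
  -- Numerator and denominator are the same series `∑ l, ‖R e_l‖²`, as `|j⟩` is a unit vector.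
  refine (div_eq_one_iff_eq (Tr_ρ_ne_zero D j)).2 ?_
  rw [Tr]
  refine tsum_congr fun l => ?_
  have e : ⟪someBasis H l, D.ρ j (someBasis H l)⟫_ℂ =
      ⟪R (someBasis H l), R (someBasis H l)⟫_ℂ := by
    rw [hRR, ContinuousLinearMap.comp_apply, ← ContinuousLinearMap.adjoint_inner_left, hR]
  rw [one_apply_eq_self, inner_ket, inner_self_eq_norm_sq_to_K (site b D j),
    (orthonormal_site b D).1 j, e]
  simp

theorem M_ket_site (i : L) (j : Supp D) (h : H) :
    M b W D i j (ket H (site b D j) h) = ket H (b i) (W.B i j h) := by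
  rw [M, tensorOp_ketBra, ContinuousLinearMap.comp_apply, ContinuousLinearMap.comp_apply,
    adjoint_ket_ket, inner_self_eq_norm_sq_to_K, (orthonormal_site b D).1 j]
  simp

theorem M_ket_site_of_ne (i : L) {j v : Supp D} (hj : j ≠ v) (h : H) :
    M b W D i j (ket H (site b D v) h) = 0 := by
  rw [M, tensorOp_ketBra, ContinuousLinearMap.comp_apply, ContinuousLinearMap.comp_apply,
    adjoint_ket_ket, (orthonormal_site b D).2 hj, zero_smul, map_zero, map_zero]

/-- The matrix coefficients of `E(x ⊗ y)` at `h ⊗ |v⟩`. -/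
theorem hasSum_inner_transExp (x y : M0 b D) (v : Supp D) (h : H) :
    HasSum (fun i => blockState b D v y *
        ⟪ket H (b i) (W.B i v h), extend b D x (ket H (b i) (W.B i v h))⟫_ℂ)
      ⟪ket H (site b D v) h, transExp b W D (x ⊗ₜ[ℂ] y) (ket H (site b D v) h)⟫_ℂ := by
  have h1 := (hasStrongSum_transExp b W D x y (ket H (site b D v) h)).mapL
    (innerSL ℂ (ket H (site b D v) h))
  have hinj : Function.Injective fun i : L => (i, v) := fun _ _ h => congrArg Prod.fst h
  -- The terms with `j ≠ v` vanish, so the series over pairs `(i, j)` reduces to the fibre `j = v`.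
  rw [innerSL_apply_apply, ← hinj.hasSum_iff] at h1
  · convert! h1 using 1
    ext i
    simp [summand, ContinuousLinearMap.adjoint_inner_right, M_ket_site]
  · rintro ⟨i, j⟩ hp
    have hj : j ≠ v := fun h => hp ⟨i, h ▸ rfl⟩
    simp [summand, M_ket_site_of_ne b W D i hj]

/-- The matrix coefficients which occur in `psi` are absolutely summable. -/
theorem summable_inner_ket_B {R : H →L[ℂ] H}
    (hs : Summable fun k => ‖R (someBasis H k)‖ ^ 2)
    (X : HilbertTensor H K →L[ℂ] HilbertTensor H K) (v : L) :
    Summable fun p : basisSet H × L =>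
      ⟪ket H (b p.2) (W.B p.2 v (R (someBasis H p.1))),
        X (ket H (b p.2) (W.B p.2 v (R (someBasis H p.1))))⟫_ℂ := by
  -- For fixed `l` the sum over `i` is `‖R e_l‖²`, which is summable over `l`.
  have h2 : Summable fun p : basisSet H × L => ‖W.B p.2 v (R (someBasis H p.1))‖ ^ 2 := by
    rw [summable_prod_of_nonneg fun _ => by positivity]
    exact ⟨fun l => (hasSum_norm_B_sq W v (R (someBasis H l))).summable,
      (summable_congr fun l => (hasSum_norm_B_sq W v (R (someBasis H l))).tsum_eq).2 hs⟩
  refine Summable.of_norm_bounded (h2.mul_left ‖X‖) fun p => ?_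
  refine (norm_inner_le_norm _ _).trans ?_
  refine (mul_le_mul_of_nonneg_left (X.le_opNorm _) (norm_nonneg _)).trans ?_
  rw [norm_ket _ (b.orthonormal.1 _)]
  exact le_of_eq (by ring)

/-- On vectors `h ⊗ |v⟩` the scalar `φ_v(y)` is common to all terms of `E(x ⊗ y)`; once it is pulled
out, the remaining double sum is the one in `ψ_v(x)`. -/
theorem blockState_transExp (x y : M0 b D) (v : Supp D) :
    blockState b D v (transExp b W D (x ⊗ₜ[ℂ] y)) = psi b W D v x * blockState b D v y := by
  obtain ⟨R, hR, hRR, hs⟩ := ρ_factor D v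
  have hpsi : psi b W D v x = 1 / Tr (D.ρ v) * ∑' l, ∑' i,
      ⟪ket H (b i) (W.B i v (R (someBasis H l))),
        extend b D x (ket H (b i) (W.B i v (R (someBasis H l))))⟫_ℂ := by
    -- In `psi` the sum over sites is outermost, whereas the trace defining `blockState` puts the
    -- basis of `H` outermost.
    have hc := Summable.tsum_comm (f := fun l i =>
      ⟪ket H (b i) (W.B i v (R (someBasis H l))),
        extend b D x (ket H (b i) (W.B i v (R (someBasis H l))))⟫_ℂ)
      (summable_inner_ket_B b W hs.summable (extend b D x) v)
    rw [psi, ← hc, hRR]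
    congr 1
    exact tsum_congr fun i => Tr_tensorOp_ketBra hR hs.summable _ (b.orthonormal.1 i) _
  rw [hpsi, blockState, Tr_tensorOp_site b D hR hs.summable hRR]
  simp_rw [← (hasSum_inner_transExp b W D x y v _).tsum_eq, tsum_mul_left]
  ring

/-- Each of the `n + 1` factors `e^⊥` contributes one `ψ_v(e^⊥)`, and the innermost `1` contributes
`φ_v(1) = 1`. -/
theorem blockState_E0_tau (e : M0 b D) (v : Supp D) (n : ℕ) :
    blockState b D v (E0 (transExp b W D) n (tau n e)) = psi b W D v (1 - e) ^ (n + 1) := by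
  induction n with
  | zero => rw [tau, E0_zero, blockState_transExp, blockState_one, mul_one, zero_add, pow_one]
  | succ n ih =>
    rw [tau, E0_succ, blockState_transExp, pow_succ', ← ih]
    -- The tail of a constant family is constant, so what is left is again `tau n e`.
    rfl

end Chain

end OQRW

theorem mainTheorem4 {H K L : Type*}
    [NormedAddCommGroup H] [InnerProductSpace ℂ H] [CompleteSpace H]
    [NormedAddCommGroup K] [InnerProductSpace ℂ K] [CompleteSpace K]
    (b : HilbertBasis L ℂ K) (W : OQRW.OpenWalk H L) (D : OQRW.BlockDensity H L)
    (e : OQRW.M0 b D) (he : IsStarProjection e) (n : ℕ) :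
    OQRW.HasStrongSum
      (fun p : L × OQRW.Supp D =>
        (OQRW.psi b W D p.2 (1 - e)) ^ (n + 1) •
          ((OQRW.M b W D p.1 p.2)† ∘L OQRW.extend b D e ∘L OQRW.M b W D p.1 p.2))
      (OQRW.transExp b W D (e ⊗ₜ[ℂ] OQRW.E0 (OQRW.transExp b W D) n (OQRW.tau n e))) := by
  -- Read backwards, the powers are the coefficients `φ_v(E_{0]}(τ^n_∞))`, and the claim becomes the
  -- strong convergence of the series defining `E`.
  simp_rw [← OQRW.blockState_E0_tau]
  exact OQRW.hasStrongSum_transExp b W D e _
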